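/- Let $n\in\mathbb{N}$ and let $T\subset\mathbb{R}^n$ be a closed set that is regular: for every $t\in T$ and $\varepsilon>0$ the set $\{x\in T:\|x-t\|<\varepsilon\}$ has positive Lebesgue measure. Let $I\subset\mathbb{Z}_+^n$ be a finite set of multi-indices with $0\in I$ that is regular: whenever $i\in I$ and $j\in\mathbb{Z}_+^n$ satisfies $j_\iota\in\{0,i_\iota\}$ for all $1\le\iota\le n$, then $j\in I$. Assume that $\max_{i\in I}|i|=2k$ with an integer $k\ge 1$, where $|i|=i_1+\cdots+i_n$, and that $2k\,\mathrm{e}_\iota\in I$ for $1\le\iota\le n$, where $\mathrm{e}_\iota$ is the $\iota$-th unit multi-index. Let $g=(g_i)_{i\in I}$ be real numbers with $g_0=1$, and let $\rho\in L^1(T,dt)$ with $\rho>0$ a.e. on $T$. Write $t^i=t_1^{i_1}\cdots t_n^{i_n}$. Then the following are equivalent: (a) There exists $f\in L^1(T,dt)$, $f\ge 0$ a.e., such that $\int_T|t^i|f(t)\,dt<\infty$ and $\int_T t^i f(t)\,dt=g_i$ for all $i\in I$. (b) The functional $L:\mathbb{R}^I\to\mathbb{R}\cup\{-\infty\}$,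 $$L(\lambda)=\sum_{i\in I}g_i\lambda_i-\int_T e^{\sum_{i\in I}\lambda_i t^i}\rho(t)\,dt,$$ is bounded from above and its supremum is attained at some $\lambda^*\in\mathbb{R}^I$. Moreover, whenever $\sup L$ is attained, the point $\lambda^*$ at which it is attained is unique. -/

import Mathlib

open MeasureTheory
open scoped ENNReal

/-- The monomial `t^i = t₁^{i₁} ⋯ tₙ^{iₙ}`. -/
def monom {n : ℕ} (i : Fin n → ℕ) (t : EuclideanSpace ℝ (Fin n)) : ℝ :=
  ∏ s : Fin n, t s ^ i s

/-- A set `T ⊆ ℝⁿ` is regular if every ball centred at a point of `T` meets `T` in a set of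
positive Lebesgue measure. -/
def IsRegularSupport {n : ℕ} (T : Set (EuclideanSpace ℝ (Fin n))) : Prop :=
  ∀ t ∈ T, ∀ ε : ℝ, 0 < ε → 0 < volume {x | x ∈ T ∧ ‖x - t‖ < ε}

/-- For a multi-index `i`, the set `σ_i` of all multi-indices `j` such that each `j_s` is either
`0` or `i_s`. -/
def sigmaSet {n : ℕ} (i : Fin n → ℕ) : Set (Fin n → ℕ) :=
  {j | ∀ s, j s = 0 ∨ j s = i s}

/-- A finite set `I` of multi-indices is regular if `σ_i ⊆ I` for every `i ∈ I`. -/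
def IsRegularIndexSet {n : ℕ} (I : Finset (Fin n → ℕ)) : Prop :=
  ∀ i ∈ I, sigmaSet i ⊆ (I : Set (Fin n → ℕ))

/-- `f` is a representing density of `g` on `T`: `f ∈ L¹₊(T, dt)`, all moments of `f` with
indices in `I` are finite (absolutely convergent), and `∫_T t^i f(t) dt = g_i` for `i ∈ I`. -/
def IsRepresentingDensity {n : ℕ} (T : Set (EuclideanSpace ℝ (Fin n)))
    (I : Finset (Fin n → ℕ)) (g : I → ℝ) (f : EuclideanSpace ℝ (Fin n) → ℝ) : Prop :=
  IntegrableOn f T volume ∧ (∀ᵐ t ∂(volume.restrict T), 0 ≤ f t) ∧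
    ∀ i : I, IntegrableOn (fun t => |monom (i : Fin n → ℕ) t| * f t) T volume ∧
      ∫ t in T, monom (i : Fin n → ℕ) t * f t = g i

/-- The Lagrangian `L(λ) = ∑_{i ∈ I} g_i λ_i - ∫_T exp(∑_{i ∈ I} λ_i t^i) ρ(t) dt`. The integrand
is a.e. nonnegative (for `ρ > 0` a.e.), its integral is taken in `[0, ∞]`, and `L(λ) = -∞`
exactly when that integral is `∞`. -/
noncomputable def lagrangian {n : ℕ} (T : Set (EuclideanSpace ℝ (Fin n)))
    (I : Finset (Fin n → ℕ)) (g : I → ℝ) (ρ : EuclideanSpace ℝ (Fin n) → ℝ)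
    (l : I → ℝ) : EReal :=
  ((∑ i : I, g i * l i : ℝ) : EReal) -
    ((∫⁻ t in T, ENNReal.ofReal
      (Real.exp (∑ i : I, l i * monom (i : Fin n → ℕ) t) * ρ t) : ℝ≥0∞) : EReal)

/-! Put μ = ρ dt on T and identify q with the polynomial ∑ q_i t^i, so that L(q) = g·q - ∫ e^q dμ.

A representing density f gives η = f dt ≪ μ. If L stayed above L(0) along an unbounded sequence,
normalising would give a limit w ≠ 0 with g·w ≥ 0. Quadratic growth of exp forces w ≤ 0 μ-a.e.,
hence η-a.e., so g·w = ∫ w dη < 0, a contradiction. Fatou and compactness then yield a maximizer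
(`exists_isLagrangianMax`).

Conversely, a maximizer l may lie on the boundary of the domain of L, so ρ e^l itself need not have
the moments g. Directions -q with q ≥ 0 stay in the domain and give ∫ q e^l dμ ≤ g·q
(`IsLagrangianMax.integral_le`). By Hahn–Banach this domination puts g among the moments of h e^l dμ
with h ≥ 0 bounded (`mem_momentCone_of_dominates`); then f = ρ e^l h.

Uniqueness is strict concavity (`IsLagrangianMax.eq`). Throughout, a nonzero polynomial vanishes
only on a null set. -/

/-! ### Zero sets of polynomials. -/

/-- A nonzero real polynomial is nonzero almost everywhere. -/
theorem MvPolynomial.ae_eval_ne_zero {n : ℕ} (p : MvPolynomial (Fin n) ℝ) (hp : p ≠ 0) :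
    ∀ᵐ x : Fin n → ℝ, MvPolynomial.eval x p ≠ 0 := by
  induction n with
  | zero =>
    refine Filter.Eventually.of_forall fun x hx => hp ?_
    refine MvPolynomial.funext fun y => ?_
    rw [Subsingleton.elim y x, hx, map_zero]
  | succ n ih =>
    have hmeas : MeasurableSet {z : (Fin n → ℝ) × ℝ |
        MvPolynomial.eval (Fin.cons z.2 z.1 : Fin (n + 1) → ℝ) p = 0} := by
      refine measurableSet_eq_fun ?_ measurable_const
      have h1 : Measurable fun x : Fin (n + 1) → ℝ => MvPolynomial.eval x p :=
        p.continuous_eval.measurable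
      refine h1.comp (measurable_pi_iff.2 fun i => ?_)
      refine Fin.cases ?_ (fun j => ?_) i
      · simpa using measurable_snd
      · simp only [Fin.cons_succ]
        exact (measurable_pi_apply j).comp measurable_fst
    have hprod : ∀ᵐ z : (Fin n → ℝ) × ℝ,
        MvPolynomial.eval (Fin.cons z.2 z.1 : Fin (n + 1) → ℝ) p ≠ 0 := by
      rw [ae_iff]
      simp only [ne_eq, not_not]
      refine (Measure.measure_prod_null hmeas).2 ?_
      -- By induction the leading coefficient in the split-off variable is nonzero at almost every
      -- s; there the slice is a nonzero univariate polynomial with finitely many roots.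
      have hq : (MvPolynomial.finSuccEquiv ℝ n p).leadingCoeff ≠ 0 := by
        simpa using hp
      filter_upwards [ih _ hq] with s hs
      have hne : Polynomial.map (MvPolynomial.eval s) (MvPolynomial.finSuccEquiv ℝ n p) ≠ 0 := by
        intro h
        apply hs
        have := congrArg (fun r => r.coeff (MvPolynomial.finSuccEquiv ℝ n p).natDegree) h
        simpa using this
      refine Set.Finite.measure_zero (Set.Finite.subset (Polynomial.finite_setOfPred_isRoot hne) ?_) _
      intro y hy
      simp only [Set.mem_preimage, Set.mem_ofPred_eq, MvPolynomial.eval_eq_eval_mv_eval'] at hy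
      exact hy
    have hmp := (Measure.measurePreserving_swap (μ := (volume : Measure ℝ))
      (ν := (volume : Measure (Fin n → ℝ)))).comp
      (volume_preserving_piFinSuccAbove (fun _ : Fin (n + 1) => ℝ) 0)
    filter_upwards [hmp.quasiMeasurePreserving.ae hprod] with x hx
    convert! hx using 3
    ext i
    refine Fin.cases ?_ (fun j => ?_) i
    · rfl
    · rfl

/-- The monomials with exponents in a finite set are linearly independent modulo null sets. -/
theorem ae_sum_mul_monom_ne_zero {n : ℕ} (I : Finset (Fin n → ℕ)) (q : I → ℝ) (hq : q ≠ 0) :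
    ∀ᵐ t : EuclideanSpace ℝ (Fin n), ∑ i : I, q i * monom (i : Fin n → ℕ) t ≠ 0 := by
  classical
  set p : MvPolynomial (Fin n) ℝ :=
    ∑ i : I, MvPolynomial.monomial (Finsupp.equivFunOnFinite.symm (i : Fin n → ℕ)) (q i) with hp
  have hp0 : p ≠ 0 := by
    obtain ⟨i, hi⟩ := Function.ne_iff.1 hq
    intro h
    apply hi
    have := congrArg (MvPolynomial.coeff (Finsupp.equivFunOnFinite.symm (i : Fin n → ℕ))) h
    rw [hp, MvPolynomial.coeff_sum, Finset.sum_eq_single i] at this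
    · simpa using this
    · intro j _ hj
      rw [MvPolynomial.coeff_monomial, if_neg]
      exact fun h => hj (Subtype.ext (Finsupp.equivFunOnFinite.symm.injective h))
    · simp
  have h := (PiLp.volume_preserving_ofLp (Fin n)).quasiMeasurePreserving.ae
    (p.ae_eval_ne_zero hp0)
  filter_upwards [h] with t ht
  convert! ht using 1
  simp [hp, monom, MvPolynomial.eval_monomial, Finsupp.prod_fintype]

/-- The linear combination `∑ q_i m_i` of the functions `m_i`. -/
def linComb {Ω ι : Type*} [Fintype ι] (m : ι → Ω → ℝ) (q : ι → ℝ) (t : Ω) : ℝ :=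
  ∑ i, q i * m i t

/-- The exponential integral `∫ exp (∑ q_i m_i) dμ` with values in `[0, ∞]`. -/
noncomputable def expIntegral {Ω ι : Type*} [Fintype ι] [MeasurableSpace Ω] (μ : Measure Ω)
    (m : ι → Ω → ℝ) (q : ι → ℝ) : ℝ≥0∞ :=
  ∫⁻ t, ENNReal.ofReal (Real.exp (linComb m q t)) ∂μ

/-- `l` maximizes `q ↦ ∑ g_i q_i - ∫ exp (∑ q_i m_i) dμ` over the `q` with finite integral. -/
def IsLagrangianMax {Ω ι : Type*} [Fintype ι] [MeasurableSpace Ω] (μ : Measure Ω)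
    (m : ι → Ω → ℝ) (g l : ι → ℝ) : Prop :=
  expIntegral μ m l ≠ ∞ ∧ ∀ q, expIntegral μ m q ≠ ∞ →
    ∑ i, g i * q i - (expIntegral μ m q).toReal ≤ ∑ i, g i * l i - (expIntegral μ m l).toReal

/-! ### The moment cone and separation. -/

section Abstract

variable {Ω ι : Type*} {m : ι → Ω → ℝ}

section Cone

variable [MeasurableSpace Ω] {μ : Measure Ω}

/-- The cone of moment vectors of bounded nonnegative measurable densities. -/
def momentCone (μ : Measure Ω) (m : ι → Ω → ℝ) : Set (ι → ℝ) :=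
  {x | ∃ h : Ω → ℝ, Measurable h ∧ (∀ t, 0 ≤ h t) ∧ (∃ C : ℝ, ∀ t, h t ≤ C) ∧
    ∀ i, ∫ t, h t * m i t ∂μ = x i}

theorem zero_mem_momentCone : (0 : ι → ℝ) ∈ momentCone μ m :=
  ⟨fun _ => 0, measurable_const, fun _ => le_rfl, ⟨0, fun _ => le_rfl⟩, by simp⟩

theorem smul_mem_momentCone {c : ℝ} (hc : 0 ≤ c) {x : ι → ℝ} (hx : x ∈ momentCone μ m) :
    c • x ∈ momentCone μ m := by
  obtain ⟨h, hm, h0, ⟨C, hC⟩, hi⟩ := hx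
  refine ⟨fun t => c * h t, hm.const_mul c, fun t => mul_nonneg hc (h0 t),
    ⟨c * C, fun t => mul_le_mul_of_nonneg_left (hC t) hc⟩, fun i => ?_⟩
  simp only [mul_assoc, integral_const_mul, hi, Pi.smul_apply, smul_eq_mul]

theorem integrable_bounded_mul {f h : Ω → ℝ} (hf : Integrable f μ) (hm : Measurable h)
    (h0 : ∀ t, 0 ≤ h t) {C : ℝ} (hC : ∀ t, h t ≤ C) : Integrable (fun t => h t * f t) μ :=
  hf.bdd_mul (c := C) hm.aestronglyMeasurable
    (Filter.Eventually.of_forall fun t => by rw [Real.norm_of_nonneg (h0 t)]; exact hC t)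

theorem convex_momentCone (hm : ∀ i, Integrable (m i) μ) : Convex ℝ (momentCone μ m) := by
  intro x hx y hy a b ha hb _
  obtain ⟨h, hm1, h0, ⟨C, hC⟩, hi⟩ := smul_mem_momentCone ha hx
  obtain ⟨h', hm', h0', ⟨C', hC'⟩, hi'⟩ := smul_mem_momentCone hb hy
  refine ⟨fun t => h t + h' t, hm1.add hm', fun t => add_nonneg (h0 t) (h0' t),
    ⟨C + C', fun t => add_le_add (hC t) (hC' t)⟩, fun i => ?_⟩
  simp only [add_mul]
  rw [integral_add (integrable_bounded_mul (hm i) hm1 h0 hC)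
    (integrable_bounded_mul (hm i) hm' h0' hC'), hi, hi', Pi.add_apply]

end Cone

variable [Fintype ι]

theorem linComb_add (a b : ι → ℝ) (t : Ω) :
    linComb m (a + b) t = linComb m a t + linComb m b t := by
  simp [linComb, add_mul, Finset.sum_add_distrib]

theorem linComb_smul (c : ℝ) (a : ι → ℝ) (t : Ω) :
    linComb m (c • a) t = c * linComb m a t := by
  simp [linComb, Finset.mul_sum, mul_assoc]

theorem linComb_zero (t : Ω) : linComb m 0 t = 0 := by simp [linComb]

theorem linComb_neg (a : ι → ℝ) (t : Ω) : linComb m (-a) t = -linComb m a t := by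
  simp [linComb]

theorem continuous_linComb (t : Ω) : Continuous fun q : ι → ℝ => linComb m q t := by
  unfold linComb
  fun_prop

theorem linComb_mul (h : Ω → ℝ) (q : ι → ℝ) (t : Ω) :
    linComb (fun i t => h t * m i t) q t = h t * linComb m q t := by
  simp only [linComb, Finset.mul_sum]
  exact Finset.sum_congr rfl fun i _ => by ring

variable [MeasurableSpace Ω] {μ : Measure Ω}

theorem measurable_linComb (hm : ∀ i, Measurable (m i)) (q : ι → ℝ) :
    Measurable (linComb m q) :=
  Finset.measurable_fun_sum _ fun i _ => (hm i).const_mul (q i)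

theorem integrable_linComb (hm : ∀ i, Integrable (m i) μ) (q : ι → ℝ) :
    Integrable (linComb m q) μ :=
  integrable_finsetSum _ fun i _ => (hm i).const_mul (q i)

theorem integral_linComb (hm : ∀ i, Integrable (m i) μ) (q : ι → ℝ) :
    ∫ t, linComb m q t ∂μ = ∑ i, q i * ∫ t, m i t ∂μ := by
  unfold linComb
  rw [integral_finsetSum _ fun i _ => (hm i).const_mul (q i)]
  simp [integral_const_mul]

theorem expIntegral_zero : expIntegral μ m 0 = μ Set.univ := by
  simp [expIntegral, linComb_zero]

theorem integral_pos_of_ae_ne_zero {f : Ω → ℝ} (hμ : μ ≠ 0) (hf : Integrable f μ)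
    (h0 : ∀ᵐ t ∂μ, 0 ≤ f t) (hne : ∀ᵐ t ∂μ, f t ≠ 0) : 0 < ∫ t, f t ∂μ := by
  refine lt_of_le_of_ne (integral_nonneg_of_ae h0) fun h => ?_
  have hz := (integral_eq_zero_iff_of_nonneg_ae h0 hf).1 h.symm
  have : ∀ᵐ t ∂μ, False := by
    filter_upwards [hz, hne] with t h1 h2 using h2 h1
  exact hμ (ae_eq_bot.1 (Filter.eventually_false_iff_eq_bot.1 this))

/-- A functional that is nonnegative on the moment cone comes from an almost everywhere nonnegative
combination. -/
theorem linComb_nonneg_of_nonneg_momentCone (hmeas : ∀ i, Measurable (m i))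
    (hm : ∀ i, Integrable (m i) μ) (q : ι → ℝ)
    (hq : ∀ x ∈ momentCone μ m, 0 ≤ ∑ i, q i * x i) : ∀ᵐ t ∂μ, 0 ≤ linComb m q t := by
  have hA : MeasurableSet {t | linComb m q t < 0} :=
    measurableSet_lt (measurable_linComb hmeas q) measurable_const
  -- Testing against this density makes the integral of q over {q < 0} nonnegative, so that set is
  -- null.
  set h : Ω → ℝ := Set.indicator {t | linComb m q t < 0} 1 with hh
  have hhm : Measurable h := measurable_one.indicator hA
  have h0 : ∀ t, 0 ≤ h t := fun t => Set.indicator_nonneg (fun _ _ => zero_le_one) t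
  have h1 : ∀ t, h t ≤ 1 := fun t => Set.indicator_le_self' (fun _ _ => zero_le_one) t
  have key := hq (fun i => ∫ t, h t * m i t ∂μ) ⟨h, hhm, h0, ⟨1, h1⟩, fun _ => rfl⟩
  have hint : ∀ i, Integrable (fun t => h t * m i t) μ := fun i =>
    integrable_bounded_mul (hm i) hhm h0 h1
  rw [← integral_linComb hint q] at key
  have hle : ∀ t, 0 ≤ -linComb (fun i t => h t * m i t) q t := by
    intro t
    rw [linComb_mul]
    by_cases ht : linComb m q t < 0
    · simpa [hh, ht] using ht.le
    · simp [hh, ht]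
  have hz : ∫ t, -linComb (fun i t => h t * m i t) q t ∂μ = 0 := by
    refine le_antisymm ?_ (integral_nonneg hle)
    rw [integral_neg]
    linarith
  have hae := (integral_eq_zero_iff_of_nonneg hle (integrable_linComb hint q).neg).1 hz
  filter_upwards [hae] with t ht
  by_contra hlt
  push Not at hlt
  have : linComb (fun i t => h t * m i t) q t = linComb m q t := by
    rw [linComb_mul, hh, Set.indicator_of_mem (by exact hlt), Pi.one_apply, one_mul]
  simp only [this, Pi.zero_apply, neg_eq_zero] at ht
  exact hlt.ne ht

theorem dual_apply_eq_sum [DecidableEq ι] (φ : (ι → ℝ) →ₗ[ℝ] ℝ) (x : ι → ℝ) :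
    φ x = ∑ i, φ (Pi.single i 1) * x i := by
  rw [LinearMap.pi_apply_eq_sum_univ φ x]
  refine Finset.sum_congr rfl fun i _ => ?_
  rw [smul_eq_mul, mul_comm]
  congr 2
  ext j
  simp [Pi.single_apply, eq_comm]

/-- A vector that dominates the moments of `μ` on all almost everywhere nonnegative combinations
is the moment vector of a measure with bounded density with respect to `μ`. -/
theorem mem_momentCone_of_dominates (hμ : μ ≠ 0) (hmeas : ∀ i, Measurable (m i))
    (hm : ∀ i, Integrable (m i) μ) (hne : ∀ q : ι → ℝ, q ≠ 0 → ∀ᵐ t ∂μ, linComb m q t ≠ 0)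
    (g : ι → ℝ) (hg : ∀ q : ι → ℝ, (∀ᵐ t ∂μ, 0 ≤ linComb m q t) →
      ∫ t, linComb m q t ∂μ ≤ ∑ i, g i * q i) : g ∈ momentCone μ m := by
  classical
  have hcoord : ∀ φ : (ι → ℝ) →ₗ[ℝ] ℝ, φ ≠ 0 → (fun i => φ (Pi.single i 1)) ≠ 0 := by
    intro φ hφ h
    apply hφ
    refine LinearMap.ext fun x => ?_
    rw [dual_apply_eq_sum]
    simp [fun i => congrFun h i]
  by_contra hgK
  -- The cone is not known to be closed, so strict separation is unavailable; weak separation needs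
  -- interior points.
  by_cases hint : (interior (momentCone μ m)).Nonempty
  · obtain ⟨φ, hφ, hle⟩ := geometric_hahn_banach_of_nonempty_interior_point
      (convex_momentCone hm) (fun h => hgK (interior_subset h)) hint
    have hnonpos : ∀ a ∈ momentCone μ m, φ a ≤ 0 := by
      intro a ha
      by_contra hpos
      push Not at hpos
      -- A positive value on the cone could be scaled past φ g.
      obtain ⟨N, hN⟩ := exists_nat_gt (φ g / φ a)
      have h1 := hle _ (smul_mem_momentCone (Nat.cast_nonneg N) ha)
      rw [map_smul, smul_eq_mul] at h1
      rw [div_lt_iff₀ hpos] at hN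
      linarith
    set q : ι → ℝ := fun i => φ.toLinearMap (Pi.single i 1) with hq
    have hφq : ∀ x, φ x = ∑ i, q i * x i := fun x => dual_apply_eq_sum φ.toLinearMap x
    have hq0 : q ≠ 0 := hcoord φ.toLinearMap (fun h => hφ (ContinuousLinearMap.coe_injective h))
    have hnn := linComb_nonneg_of_nonneg_momentCone hmeas hm (-q) (fun x hx => by
      have := hnonpos x hx
      rw [hφq] at this
      simpa using this)
    -- Contradiction: 0 < ∫ (-q) dμ ≤ -φ g ≤ 0, the last because 0 lies in the cone.
    have h1 := integral_pos_of_ae_ne_zero hμ (integrable_linComb hm (-q)) hnn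
      (hne _ (neg_ne_zero.2 hq0))
    have h2 := hg _ hnn
    have h3 := hle 0 zero_mem_momentCone
    rw [map_zero, hφq] at h3
    have h4 : ∑ i, g i * (-q) i = -∑ i, q i * g i := by
      simp [mul_comm]
    linarith
  -- Without interior the cone lies in a hyperplane; the functional defining it is both ≥ 0 and ≤ 0
  -- a.e. as a combination of the `m i`, hence zero a.e.
  · rw [(convex_momentCone hm).interior_nonempty_iff_affineSpan_eq_top] at hint
    have hspan : Submodule.span ℝ (momentCone μ m) < ⊤ := by
      refine lt_top_iff_ne_top.2 fun h => hint ?_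
      rw [← Set.insert_eq_of_mem (zero_mem_momentCone (μ := μ) (m := m))]
      refine SetLike.coe_injective ?_
      rw [affineSpan_insert_zero, h]
      simp
    obtain ⟨φ, hφ, hker⟩ := Submodule.exists_le_ker_of_lt_top _ hspan
    have hzero : ∀ x ∈ momentCone μ m, ∑ i, φ (Pi.single i 1) * x i = 0 := fun x hx => by
      rw [← dual_apply_eq_sum]
      exact hker (Submodule.subset_span hx)
    set q : ι → ℝ := fun i => φ (Pi.single i 1) with hq
    have hn1 := linComb_nonneg_of_nonneg_momentCone hmeas hm q (fun x hx => (hzero x hx).ge)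
    have hn2 := linComb_nonneg_of_nonneg_momentCone hmeas hm (-q) (fun x hx => by
      simpa using (hzero x hx).le)
    have : ∀ᵐ t ∂μ, False := by
      filter_upwards [hn1, hn2, hne q (hcoord φ hφ)] with t h1 h2 h3
      rw [linComb_neg] at h2
      exact h3 (le_antisymm (by linarith) h1)
    exact hμ (ae_eq_bot.1 (Filter.eventually_false_iff_eq_bot.1 this))

end Abstract

/-! ### Maximizers: first-order condition, uniqueness, existence. -/

section Lagrangian

open Filter Topology

variable {Ω ι : Type*} [Fintype ι] [MeasurableSpace Ω] {μ : Measure Ω} {m : ι → Ω → ℝ}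

theorem integrable_exp_linComb (hmeas : ∀ i, Measurable (m i)) {q : ι → ℝ}
    (hq : expIntegral μ m q ≠ ∞) : Integrable (fun t => Real.exp (linComb m q t)) μ :=
  (lintegral_ofReal_ne_top_iff_integrable
    (measurable_linComb hmeas q).exp.aestronglyMeasurable
    (Eventually.of_forall fun _ => (Real.exp_pos _).le)).1 hq

theorem toReal_expIntegral (hmeas : ∀ i, Measurable (m i)) (q : ι → ℝ) :
    (expIntegral μ m q).toReal = ∫ t, Real.exp (linComb m q t) ∂μ :=
  (integral_eq_lintegral_of_nonneg_ae (Eventually.of_forall fun _ => (Real.exp_pos _).le)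
    (measurable_linComb hmeas q).exp.aestronglyMeasurable).symm

/-- Follows from e^x ≥ 1 + x. It bounds the difference quotients of the exponential integral below
by nonnegative functions with an explicit pointwise limit, ready for Fatou. -/
theorem mul_div_one_add_le_one_sub_exp_neg {x : ℝ} (hx : 0 ≤ x) :
    x / (1 + x) ≤ 1 - Real.exp (-x) := by
  have h1 : Real.exp (-x) ≤ (1 + x)⁻¹ := by
    rw [Real.exp_neg]
    exact inv_anti₀ (by linarith) (by linarith [Real.add_one_le_exp x])
  have h2 : x / (1 + x) = 1 - (1 + x)⁻¹ := by
    field_simp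
    ring
  linarith

/-- At a maximizer `l`, the moments of `exp (∑ l_i m_i) dμ` are dominated by `g` on the
almost everywhere nonnegative combinations. -/
theorem IsLagrangianMax.lintegral_le (hmeas : ∀ i, Measurable (m i)) {g l : ι → ℝ}
    (hl : IsLagrangianMax μ m g l) {q : ι → ℝ} (hq : ∀ᵐ t ∂μ, 0 ≤ linComb m q t) :
    0 ≤ ∑ i, g i * q i ∧
    ∫⁻ t, ENNReal.ofReal (linComb m q t * Real.exp (linComb m l t)) ∂μ ≤
      ENNReal.ofReal (∑ i, g i * q i) := by
  set G := ∑ i, g i * q i with hG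
  have hexp : ∀ ε : ℝ, ∀ t, Real.exp (linComb m (l + (-ε) • q) t) =
      Real.exp (linComb m l t) * Real.exp (-(ε * linComb m q t)) := by
    intro ε t
    rw [linComb_add, linComb_smul, Real.exp_add, neg_mul]
  have hfin : ∀ ε : ℝ, 0 ≤ ε → expIntegral μ m (l + (-ε) • q) ≠ ∞ := by
    intro ε hε
    refine ne_top_of_le_ne_top hl.1 (lintegral_mono_ae ?_)
    filter_upwards [hq] with t ht
    refine ENNReal.ofReal_le_ofReal ?_
    rw [hexp]
    exact mul_le_of_le_one_right (Real.exp_pos _).le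
      (Real.exp_le_one_iff.2 (neg_nonpos.2 (mul_nonneg hε ht)))
  -- Optimality against l - εq, divided by ε.
  have hdiff : ∀ ε : ℝ, 0 < ε →
      ∫⁻ t, ENNReal.ofReal (linComb m q t / (1 + ε * linComb m q t) *
        Real.exp (linComb m l t)) ∂μ ≤ ENNReal.ofReal G ∧ 0 ≤ G := by
    intro ε hε
    have hi1 := integrable_exp_linComb hmeas hl.1
    have hi2 := integrable_exp_linComb hmeas (hfin ε hε.le)
    have hopt := hl.2 _ (hfin ε hε.le)
    rw [toReal_expIntegral hmeas, toReal_expIntegral hmeas] at hopt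
    have hsum : ∑ i, g i * (l + (-ε) • q) i = ∑ i, g i * l i - ε * G := by
      rw [hG, Finset.mul_sum, ← Finset.sum_sub_distrib]
      refine Finset.sum_congr rfl fun i _ => ?_
      simp only [Pi.add_apply, Pi.smul_apply, smul_eq_mul]
      ring
    rw [hsum] at hopt
    have hint : ∫ t, ε⁻¹ * (Real.exp (linComb m l t) -
        Real.exp (linComb m (l + (-ε) • q) t)) ∂μ ≤ G := by
      rw [integral_const_mul, integral_sub hi1 hi2, inv_mul_le_iff₀ hε]
      linarith
    have hnn : ∀ᵐ t ∂μ, 0 ≤ linComb m q t / (1 + ε * linComb m q t) *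
        Real.exp (linComb m l t) := by
      filter_upwards [hq] with t ht
      positivity
    have hle : ∀ᵐ t ∂μ, linComb m q t / (1 + ε * linComb m q t) * Real.exp (linComb m l t) ≤
        ε⁻¹ * (Real.exp (linComb m l t) - Real.exp (linComb m (l + (-ε) • q) t)) := by
      filter_upwards [hq] with t ht
      rw [hexp]
      have h1 := mul_div_one_add_le_one_sub_exp_neg (mul_nonneg hε.le ht)
      have h2 := mul_le_mul_of_nonneg_right h1
        (mul_nonneg (inv_nonneg.2 hε.le) (Real.exp_pos (linComb m l t)).le)
      calc _ = ε * linComb m q t / (1 + ε * linComb m q t) *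
            (ε⁻¹ * Real.exp (linComb m l t)) := by field_simp
        _ ≤ _ := h2
        _ = _ := by ring
    have hnn' : 0 ≤ᵐ[μ] fun t =>
        ε⁻¹ * (Real.exp (linComb m l t) - Real.exp (linComb m (l + (-ε) • q) t)) := by
      filter_upwards [hnn, hle] with t h1 h2 using h1.trans h2
    refine ⟨?_, (integral_nonneg_of_ae hnn').trans hint⟩
    refine (lintegral_mono_ae (hle.mono fun t ht => ENNReal.ofReal_le_ofReal ht)).trans ?_
    have hi : Integrable (fun t =>
        ε⁻¹ * (Real.exp (linComb m l t) - Real.exp (linComb m (l + (-ε) • q) t))) μ :=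
      (hi1.sub hi2).const_mul _
    rw [← ofReal_integral_eq_lintegral_ofReal hi hnn']
    exact ENNReal.ofReal_le_ofReal hint
  -- The sign of G is recorded separately because `ENNReal.ofReal` truncates negative values.
  refine ⟨(hdiff 1 one_pos).2, ?_⟩
  have hlim : ∀ t, Tendsto (fun N : ℕ => ENNReal.ofReal (linComb m q t /
      (1 + (1 / ((N : ℝ) + 1)) * linComb m q t) * Real.exp (linComb m l t))) atTop
      (𝓝 (ENNReal.ofReal (linComb m q t * Real.exp (linComb m l t)))) := by
    intro t
    refine ENNReal.tendsto_ofReal (Tendsto.mul_const _ ?_)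
    have h1 : Tendsto (fun N : ℕ => 1 + (1 / ((N : ℝ) + 1)) * linComb m q t) atTop (𝓝 1) := by
      simpa using (tendsto_one_div_add_atTop_nhds_zero_nat.mul_const (linComb m q t)).const_add 1
    have h2 := (tendsto_const_nhds (x := linComb m q t)).div h1 one_ne_zero
    rwa [div_one] at h2
  have hp := measurable_linComb hmeas q
  have hpl := measurable_linComb hmeas l
  calc ∫⁻ t, ENNReal.ofReal (linComb m q t * Real.exp (linComb m l t)) ∂μ
      = ∫⁻ t, liminf (fun N : ℕ => ENNReal.ofReal (linComb m q t /
          (1 + (1 / ((N : ℝ) + 1)) * linComb m q t) * Real.exp (linComb m l t))) atTop ∂μ :=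
        lintegral_congr fun t => (hlim t).liminf_eq.symm
    _ ≤ liminf (fun N : ℕ => ∫⁻ t, ENNReal.ofReal (linComb m q t /
          (1 + (1 / ((N : ℝ) + 1)) * linComb m q t) * Real.exp (linComb m l t)) ∂μ) atTop :=
        lintegral_liminf_le fun N => by fun_prop
    _ ≤ ENNReal.ofReal G := by
        refine liminf_le_of_le (by isBoundedDefault) fun b hb => ?_
        obtain ⟨N, hN⟩ := hb.exists
        exact hN.trans (hdiff _ Nat.one_div_pos_of_nat).1

theorem IsLagrangianMax.integrable (hmeas : ∀ i, Measurable (m i)) {g l : ι → ℝ}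
    (hl : IsLagrangianMax μ m g l) {q : ι → ℝ} (hq : ∀ᵐ t ∂μ, 0 ≤ linComb m q t) :
    Integrable (fun t => linComb m q t * Real.exp (linComb m l t)) μ := by
  refine (lintegral_ofReal_ne_top_iff_integrable
    ((measurable_linComb hmeas q).mul (measurable_linComb hmeas l).exp).aestronglyMeasurable
    (hq.mono fun t ht => mul_nonneg ht (Real.exp_pos _).le)).1 ?_
  exact ne_top_of_le_ne_top ENNReal.ofReal_ne_top (hl.lintegral_le hmeas hq).2

theorem IsLagrangianMax.integral_le (hmeas : ∀ i, Measurable (m i)) {g l : ι → ℝ}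
    (hl : IsLagrangianMax μ m g l) {q : ι → ℝ} (hq : ∀ᵐ t ∂μ, 0 ≤ linComb m q t) :
    ∫ t, linComb m q t * Real.exp (linComb m l t) ∂μ ≤ ∑ i, g i * q i := by
  rw [integral_eq_lintegral_of_nonneg_ae
    (hq.mono fun t ht => mul_nonneg ht (Real.exp_pos _).le)
    (hl.integrable hmeas hq).aestronglyMeasurable]
  exact ENNReal.toReal_le_of_le_ofReal (hl.lintegral_le hmeas hq).1 (hl.lintegral_le hmeas hq).2

/-- The Lagrangian is strictly concave where it is finite, so its maximizer is unique. -/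
theorem IsLagrangianMax.eq (hμ : μ ≠ 0) (hmeas : ∀ i, Measurable (m i))
    (hne : ∀ q : ι → ℝ, q ≠ 0 → ∀ᵐ t ∂μ, linComb m q t ≠ 0) {g a b : ι → ℝ}
    (ha : IsLagrangianMax μ m g a) (hb : IsLagrangianMax μ m g b) : a = b := by
  by_contra hab
  set c : ι → ℝ := (1 / 2 : ℝ) • (a + b) with hc
  have hia := integrable_exp_linComb hmeas ha.1
  have hib := integrable_exp_linComb hmeas hb.1
  -- The midpoint convexity gap is a square that vanishes only where the two exponents agree.
  have hsq : ∀ t, Real.exp (linComb m a t) + Real.exp (linComb m b t) -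
      2 * Real.exp (linComb m c t) =
      (Real.exp (linComb m a t / 2) - Real.exp (linComb m b t / 2)) ^ 2 := by
    intro t
    have h1 : linComb m c t = linComb m a t / 2 + linComb m b t / 2 := by
      rw [hc, linComb_smul, linComb_add]
      ring
    have h2 : ∀ x : ℝ, Real.exp x = Real.exp (x / 2) ^ 2 := fun x => by
      rw [← Real.exp_nat_mul]
      congr 1
      push_cast
      ring
    rw [h1, Real.exp_add, h2 (linComb m a t), h2 (linComb m b t)]
    ring
  have hic : Integrable (fun t => Real.exp (linComb m c t)) μ := by
    refine (hia.add hib).mono' (measurable_linComb hmeas c).exp.aestronglyMeasurable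
      (Eventually.of_forall fun t => ?_)
    rw [Real.norm_of_nonneg (Real.exp_pos _).le, Pi.add_apply]
    nlinarith [hsq t, sq_nonneg (Real.exp (linComb m a t / 2) - Real.exp (linComb m b t / 2)),
      Real.exp_pos (linComb m c t)]
  have hcfin : expIntegral μ m c ≠ ∞ :=
    (lintegral_ofReal_ne_top_iff_integrable hic.aestronglyMeasurable
      (Eventually.of_forall fun _ => (Real.exp_pos _).le)).2 hic
  have hiab : Integrable (fun t => Real.exp (linComb m a t) + Real.exp (linComb m b t)) μ :=
    hia.add hib
  have hpos : 0 < ∫ t, (Real.exp (linComb m a t) + Real.exp (linComb m b t) -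
      2 * Real.exp (linComb m c t)) ∂μ := by
    refine integral_pos_of_ae_ne_zero hμ (hiab.sub (hic.const_mul 2))
      (Eventually.of_forall fun t => ?_) ?_
    · rw [hsq]
      positivity
    · filter_upwards [hne (a + -b) (by rwa [← sub_eq_add_neg, sub_ne_zero])] with t ht
      rw [hsq]
      refine pow_ne_zero 2 (sub_ne_zero.2 fun h => ht ?_)
      have := Real.exp_injective h
      rw [linComb_add, linComb_neg]
      linarith
  have h1 := ha.2 c hcfin
  have h2 := hb.2 c hcfin
  rw [toReal_expIntegral hmeas, toReal_expIntegral hmeas] at h1 h2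
  rw [integral_sub hiab (hic.const_mul 2), integral_add hia hib,
    integral_const_mul] at hpos
  have h3 : ∑ i, g i * c i = (∑ i, g i * a i + ∑ i, g i * b i) / 2 := by
    rw [← Finset.sum_add_distrib, Finset.sum_div]
    refine Finset.sum_congr rfl fun i _ => ?_
    simp only [hc, Pi.smul_apply, Pi.add_apply, smul_eq_mul]
    ring
  linarith

/-- For μ = 0 the functional is linear, and a step along g raises it by ∑ g_i² > 0. -/
theorem IsLagrangianMax.measure_ne_zero {g l : ι → ℝ} (hl : IsLagrangianMax μ m g l) (hg : g ≠ 0) :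
    μ ≠ 0 := by
  rintro rfl
  have h := hl.2 (l + g) (by simp [expIntegral])
  simp only [expIntegral, lintegral_zero_measure, Pi.add_apply, mul_add,
    Finset.sum_add_distrib] at h
  obtain ⟨j, hj⟩ := Function.ne_iff.1 hg
  have : 0 < ∑ i, g i * g i :=
    Finset.sum_pos' (fun i _ => mul_self_nonneg _) ⟨j, Finset.mem_univ j, mul_self_pos.2 hj⟩
  linarith

theorem lowerSemicontinuous_expIntegral (hmeas : ∀ i, Measurable (m i)) :
    LowerSemicontinuous (expIntegral μ m) := by
  refine lowerSemicontinuous_iff_le_liminf.2 fun q => ?_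
  have hlim : ∀ t, liminf (fun q => ENNReal.ofReal (Real.exp (linComb m q t))) (𝓝 q) =
      ENNReal.ofReal (Real.exp (linComb m q t)) := fun t =>
    (ENNReal.tendsto_ofReal
      ((Real.continuous_exp.comp (continuous_linComb (m := m) t)).tendsto q)).liminf_eq
  calc expIntegral μ m q
      = ∫⁻ t, liminf (fun q => ENNReal.ofReal (Real.exp (linComb m q t))) (𝓝 q) ∂μ :=
        (lintegral_congr hlim).symm
    _ ≤ _ := lintegral_liminf_le fun q => (measurable_linComb hmeas q).exp.ennreal_ofReal

theorem sum_mul_le_mul_norm (g q : ι → ℝ) : ∑ i, g i * q i ≤ (∑ i, |g i|) * ‖q‖ := by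
  rw [Finset.sum_mul]
  refine Finset.sum_le_sum fun i _ => (le_abs_self _).trans ?_
  rw [abs_mul]
  exact mul_le_mul_of_nonneg_left (norm_le_pi_norm q i) (abs_nonneg _)

/-- If `g` consists of the moments of a nonzero measure `η ≪ μ`, the superlevel set of the
Lagrangian at its value in the origin is bounded. -/
theorem exists_norm_le_of_lagrangian_ge [IsFiniteMeasure μ] {η : Measure Ω} (hημ : η ≪ μ)
    (hη : η ≠ 0) (hmeas : ∀ i, Measurable (m i)) (hint : ∀ i, Integrable (m i) η)
    (hne : ∀ q : ι → ℝ, q ≠ 0 → ∀ᵐ t ∂η, linComb m q t ≠ 0) {g : ι → ℝ}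
    (hg : ∀ i, ∫ t, m i t ∂η = g i) :
    ∃ R : ℝ, ∀ q : ι → ℝ, expIntegral μ m q ≠ ∞ →
      -(μ Set.univ).toReal ≤ ∑ i, g i * q i - (expIntegral μ m q).toReal → ‖q‖ ≤ R := by
  by_contra hcon
  push Not at hcon
  -- The shift by 1 gives ‖u N‖ ≥ 1, so constants can be absorbed into multiples of the norm.
  choose u hufin hu hun using fun N : ℕ => hcon ((N : ℝ) + 1)
  set M := (μ Set.univ).toReal with hM
  set C := ∑ i, |g i| with hC
  have hM0 : 0 ≤ M := ENNReal.toReal_nonneg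
  set r : ℕ → ℝ := fun N => ‖u N‖ with hr
  have hr1 : ∀ N, 1 ≤ r N := fun N => by
    have := hun N
    have h2 : (0 : ℝ) ≤ N := N.cast_nonneg
    simp only [hr]
    linarith
  have hr0 : ∀ N, 0 < r N := fun N => one_pos.trans_le (hr1 N)
  have hrtop : Tendsto r atTop atTop := by
    refine tendsto_atTop_mono (fun N => ?_) tendsto_natCast_atTop_atTop
    have := hun N
    simp only [hr]
    linarith
  have hinv : Tendsto (fun N => (r N)⁻¹) atTop (𝓝 0) := tendsto_inv_atTop_zero.comp hrtop
  set v : ℕ → ι → ℝ := fun N => (r N)⁻¹ • u N with hv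
  have huv : ∀ N, u N = r N • v N := fun N => by
    simp only [hv, smul_smul, mul_inv_cancel₀ (hr0 N).ne', one_smul]
  have hvs : ∀ N, v N ∈ Metric.sphere (0 : ι → ℝ) 1 := fun N => by
    rw [mem_sphere_zero_iff_norm, hv]
    simp only [norm_smul, norm_inv, Real.norm_of_nonneg (hr0 N).le]
    exact inv_mul_cancel₀ (hr0 N).ne'
  obtain ⟨w, hw, φ, hφ, hlim⟩ := (isCompact_sphere (0 : ι → ℝ) 1).tendsto_subseq hvs
  have hw0 : w ≠ 0 := by
    rintro rfl
    simp at hw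
  have hinv' : Tendsto (fun N => (r (φ N))⁻¹) atTop (𝓝 0) := hinv.comp hφ.tendsto_atTop
  have hgv : ∀ N, ∑ i, g i * u N i = r N * ∑ i, g i * v N i := fun N => by
    rw [huv N, Finset.mul_sum]
    refine Finset.sum_congr rfl fun i _ => ?_
    simp only [Pi.smul_apply, smul_eq_mul]
    ring
  have hgw : 0 ≤ ∑ i, g i * w i := by
    have h1 : Tendsto (fun N => ∑ i, g i * v (φ N) i) atTop (𝓝 (∑ i, g i * w i)) := by
      have hcont : Continuous fun x : ι → ℝ => ∑ i, g i * x i := by fun_prop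
      exact (hcont.tendsto w).comp hlim
    have h2 : Tendsto (fun N => -M * (r (φ N))⁻¹) atTop (𝓝 0) := by
      simpa using hinv'.const_mul (-M)
    refine le_of_tendsto_of_tendsto' h2 h1 fun N => ?_
    rw [← div_eq_mul_inv, div_le_iff₀ (hr0 _), mul_comm, ← hgv]
    have := hu (φ N)
    have h3 : 0 ≤ (expIntegral μ m (u (φ N))).toReal := ENNReal.toReal_nonneg
    linarith
  -- The exponential integral is at most (C + M) r, while x²/2 ≤ e^x for x ≥ 0 yields a factor r²;
  -- their quotient tends to 0.
  have hbound : ∀ N, ∫⁻ t, ENNReal.ofReal (max (linComb m (v N) t) 0 ^ 2) ∂μ ≤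
      ENNReal.ofReal (2 * ((C + M) * (r N)⁻¹)) := by
    intro N
    have hJ : (expIntegral μ m (u N)).toReal ≤ (C + M) * r N := by
      have h1 := sum_mul_le_mul_norm g (u N)
      have h2 : M ≤ M * r N := le_mul_of_one_le_right hM0 (hr1 N)
      have h3 := hu N
      simp only [hr, hC] at *
      linarith
    have hpt : ∀ t, ENNReal.ofReal (max (linComb m (v N) t) 0 ^ 2) ≤
        ENNReal.ofReal (2 * (r N)⁻¹ ^ 2) * ENNReal.ofReal (Real.exp (linComb m (u N) t)) := by
      intro t
      rw [← ENNReal.ofReal_mul (by positivity)]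
      refine ENNReal.ofReal_le_ofReal ?_
      rcases le_total (linComb m (v N) t) 0 with h | h
      · rw [max_eq_right h]
        rw [zero_pow two_ne_zero]
        exact mul_nonneg (by positivity) (Real.exp_pos _).le
      · rw [max_eq_left h]
        have h1 : linComb m (u N) t = r N * linComb m (v N) t := by
          rw [huv N, linComb_smul]
        have h0 : 0 ≤ r N * linComb m (v N) t := mul_nonneg (hr0 N).le h
        have h2 := Real.quadratic_le_exp_of_nonneg h0
        rw [h1]
        have h3 : (r N * linComb m (v N) t) ^ 2 / 2 ≤ Real.exp (r N * linComb m (v N) t) := by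
          linarith
        calc linComb m (v N) t ^ 2
            = 2 * (r N)⁻¹ ^ 2 * ((r N * linComb m (v N) t) ^ 2 / 2) := by
              have := (hr0 N).ne'
              field_simp
          _ ≤ _ := mul_le_mul_of_nonneg_left h3 (by positivity)
    calc ∫⁻ t, ENNReal.ofReal (max (linComb m (v N) t) 0 ^ 2) ∂μ
        ≤ ∫⁻ t, ENNReal.ofReal (2 * (r N)⁻¹ ^ 2) *
            ENNReal.ofReal (Real.exp (linComb m (u N) t)) ∂μ := lintegral_mono hpt
      _ = ENNReal.ofReal (2 * (r N)⁻¹ ^ 2) * expIntegral μ m (u N) :=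
          lintegral_const_mul' _ _ ENNReal.ofReal_ne_top
      _ = ENNReal.ofReal (2 * (r N)⁻¹ ^ 2 * (expIntegral μ m (u N)).toReal) := by
          rw [ENNReal.ofReal_mul (p := 2 * (r N)⁻¹ ^ 2) (by positivity),
            ENNReal.ofReal_toReal (hufin N)]
      _ ≤ ENNReal.ofReal (2 * ((C + M) * (r N)⁻¹)) := by
          refine ENNReal.ofReal_le_ofReal ?_
          calc 2 * (r N)⁻¹ ^ 2 * (expIntegral μ m (u N)).toReal
              ≤ 2 * (r N)⁻¹ ^ 2 * ((C + M) * r N) :=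
                mul_le_mul_of_nonneg_left hJ (by positivity)
            _ = _ := by
                have := (hr0 N).ne'
                field_simp
  have hzero : ∫⁻ t, ENNReal.ofReal (max (linComb m w t) 0 ^ 2) ∂μ = 0 := by
    have hpt : ∀ t, Tendsto (fun N => ENNReal.ofReal (max (linComb m (v (φ N)) t) 0 ^ 2)) atTop
        (𝓝 (ENNReal.ofReal (max (linComb m w t) 0 ^ 2))) := fun t => by
      have h1 := ((continuous_linComb (m := m) t).tendsto w).comp hlim
      exact ENNReal.tendsto_ofReal ((h1.max tendsto_const_nhds).pow 2)
    have hrhs : Tendsto (fun N => ENNReal.ofReal (2 * ((C + M) * (r (φ N))⁻¹))) atTop (𝓝 0) := by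
      simpa using ENNReal.tendsto_ofReal ((hinv'.const_mul (C + M)).const_mul 2)
    refine le_antisymm ?_ zero_le
    calc ∫⁻ t, ENNReal.ofReal (max (linComb m w t) 0 ^ 2) ∂μ
        = ∫⁻ t, liminf (fun N => ENNReal.ofReal (max (linComb m (v (φ N)) t) 0 ^ 2)) atTop ∂μ :=
          lintegral_congr fun t => (hpt t).liminf_eq.symm
      _ ≤ liminf (fun N => ∫⁻ t, ENNReal.ofReal (max (linComb m (v (φ N)) t) 0 ^ 2) ∂μ) atTop :=
          lintegral_liminf_le fun N =>
            (((measurable_linComb hmeas _).max measurable_const).pow_const 2).ennreal_ofReal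
      _ ≤ liminf (fun N => ENNReal.ofReal (2 * ((C + M) * (r (φ N))⁻¹))) atTop :=
          liminf_le_liminf (Eventually.of_forall fun N => hbound (φ N))
      _ = 0 := hrhs.liminf_eq
  have hnonpos : ∀ᵐ t ∂μ, linComb m w t ≤ 0 := by
    rw [lintegral_eq_zero_iff
      (((measurable_linComb hmeas w).max measurable_const).pow_const 2).ennreal_ofReal] at hzero
    filter_upwards [hzero] with t ht
    have h1 : max (linComb m w t) 0 ^ 2 ≤ 0 := ENNReal.ofReal_eq_zero.1 ht
    have h2 : max (linComb m w t) 0 = 0 := pow_eq_zero_iff two_ne_zero |>.1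
      (le_antisymm h1 (sq_nonneg _))
    exact max_eq_right_iff.1 h2
  -- Since w ≤ 0 also holds η-a.e., this gives g·w < 0, against `hgw`.
  have hpos := integral_pos_of_ae_ne_zero hη (integrable_linComb hint (-w))
    ((Eventually.filter_mono hημ.ae_le hnonpos).mono fun t ht => by
      rw [linComb_neg]
      exact neg_nonneg.2 ht) (hne _ (neg_ne_zero.2 hw0))
  rw [integral_linComb hint] at hpos
  simp only [hg, Pi.neg_apply, neg_mul, Finset.sum_neg_distrib] at hpos
  simp only [mul_comm (w _)] at hpos
  linarith

/-- If `g` consists of the moments of a nonzero measure `η ≪ μ`, the Lagrangian has a maximizer. -/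
theorem exists_isLagrangianMax [IsFiniteMeasure μ] {η : Measure Ω} (hημ : η ≪ μ)
    (hη : η ≠ 0) (hmeas : ∀ i, Measurable (m i)) (hint : ∀ i, Integrable (m i) η)
    (hne : ∀ q : ι → ℝ, q ≠ 0 → ∀ᵐ t ∂η, linComb m q t ≠ 0) {g : ι → ℝ}
    (hg : ∀ i, ∫ t, m i t ∂η = g i) : ∃ l, IsLagrangianMax μ m g l := by
  obtain ⟨R, hR⟩ := exists_norm_le_of_lagrangian_ge hημ hη hmeas hint hne hg
  -- With this constant B - g·q ≥ 0 on the ball, so B - L can be minimized in [0, ∞]; `max R 0`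
  -- keeps the origin inside.
  set B := (∑ i, |g i|) * max R 0 with hB
  have hBle : ∀ q ∈ Metric.closedBall (0 : ι → ℝ) (max R 0), 0 ≤ B - ∑ i, g i * q i := by
    intro q hq
    rw [mem_closedBall_zero_iff] at hq
    have h1 := sum_mul_le_mul_norm g q
    have h2 := mul_le_mul_of_nonneg_left hq
      (Finset.sum_nonneg fun i (_ : i ∈ Finset.univ) => abs_nonneg (g i))
    linarith
  have hlsc : LowerSemicontinuous fun q : ι → ℝ =>
      expIntegral μ m q + ENNReal.ofReal (B - ∑ i, g i * q i) := by
    refine (lowerSemicontinuous_expIntegral hmeas).add (Continuous.lowerSemicontinuous ?_)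
    exact ENNReal.continuous_ofReal.comp (by fun_prop)
  have h0mem : (0 : ι → ℝ) ∈ Metric.closedBall (0 : ι → ℝ) (max R 0) :=
    Metric.mem_closedBall_self (le_max_right _ _)
  obtain ⟨l, hlmem, hlmin⟩ := LowerSemicontinuousOn.exists_isMinOn ⟨0, h0mem⟩
    (isCompact_closedBall (0 : ι → ℝ) (max R 0)) (hlsc.lowerSemicontinuousOn _)
  have h0fin : expIntegral μ m 0 ≠ ∞ := by
    rw [expIntegral_zero]
    exact measure_ne_top _ _
  have hlfin : expIntegral μ m l ≠ ∞ := by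
    refine ne_top_of_le_ne_top ?_ (le_self_add.trans (hlmin h0mem))
    exact ENNReal.add_ne_top.2 ⟨h0fin, ENNReal.ofReal_ne_top⟩
  have hball : ∀ q ∈ Metric.closedBall (0 : ι → ℝ) (max R 0), expIntegral μ m q ≠ ∞ →
      ∑ i, g i * q i - (expIntegral μ m q).toReal ≤
        ∑ i, g i * l i - (expIntegral μ m l).toReal := by
    intro q hq hqfin
    have h1 := ENNReal.toReal_mono (ENNReal.add_ne_top.2 ⟨hqfin, ENNReal.ofReal_ne_top⟩)
      (hlmin hq)
    rw [ENNReal.toReal_add hlfin ENNReal.ofReal_ne_top,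
      ENNReal.toReal_add hqfin ENNReal.ofReal_ne_top, ENNReal.toReal_ofReal (hBle l hlmem),
      ENNReal.toReal_ofReal (hBle q hq)] at h1
    linarith
  refine ⟨l, hlfin, fun q hqfin => ?_⟩
  by_cases hq : q ∈ Metric.closedBall (0 : ι → ℝ) (max R 0)
  · exact hball q hq hqfin
  -- A point beating l also beats the origin, so the coercivity bound puts it in the ball.
  · have h0 := hball 0 h0mem h0fin
    rw [expIntegral_zero] at h0
    simp only [Pi.zero_apply, mul_zero, Finset.sum_const_zero, zero_sub] at h0
    by_contra hlt
    push Not at hlt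
    refine hq (mem_closedBall_zero_iff.2 ((hR q hqfin ?_).trans (le_max_left _ _)))
    linarith

end Lagrangian

/-! ### Integration against a real density. -/

section Density

variable {Ω : Type*} [MeasurableSpace Ω] {ν : Measure Ω} {f : Ω → ℝ}

theorem integral_withDensity_ofReal (hf : AEMeasurable f ν) (h0 : ∀ᵐ t ∂ν, 0 ≤ f t)
    (F : Ω → ℝ) :
    ∫ t, F t ∂ν.withDensity (fun t => ENNReal.ofReal (f t)) = ∫ t, f t * F t ∂ν := by
  rw [integral_withDensity_eq_integral_toReal_smul₀ hf.ennreal_ofReal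
    (Filter.Eventually.of_forall fun _ => ENNReal.ofReal_lt_top)]
  refine integral_congr_ae ?_
  filter_upwards [h0] with t ht
  rw [ENNReal.toReal_ofReal ht, smul_eq_mul]

theorem integrable_withDensity_ofReal_iff (hf : AEMeasurable f ν) (h0 : ∀ᵐ t ∂ν, 0 ≤ f t)
    {F : Ω → ℝ} :
    Integrable F (ν.withDensity fun t => ENNReal.ofReal (f t)) ↔
      Integrable (fun t => f t * F t) ν := by
  rw [integrable_withDensity_iff_integrable_smul₀' hf.ennreal_ofReal
    (Filter.Eventually.of_forall fun _ => ENNReal.ofReal_lt_top)]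
  refine integrable_congr ?_
  filter_upwards [h0] with t ht
  rw [ENNReal.toReal_ofReal ht, smul_eq_mul]

theorem absolutelyContinuous_withDensity_ofReal (hf : AEMeasurable f ν)
    (h0 : ∀ᵐ t ∂ν, 0 < f t) : ν ≪ ν.withDensity fun t => ENNReal.ofReal (f t) :=
  withDensity_absolutelyContinuous' hf.ennreal_ofReal
    (h0.mono fun _ ht => (ENNReal.ofReal_pos.2 ht).ne')

end Density

/-! ### Bounds on monomials. -/

section Monomials

variable {n : ℕ}

theorem continuous_monom (i : Fin n → ℕ) : Continuous (monom i) := by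
  unfold monom
  fun_prop

theorem monom_zero (t : EuclideanSpace ℝ (Fin n)) : monom 0 t = 1 := by
  simp [monom]

theorem monom_single (s : Fin n) (d : ℕ) (t : EuclideanSpace ℝ (Fin n)) :
    monom (Pi.single s d) t = t s ^ d := by
  rw [monom, Finset.prod_eq_single s]
  · simp
  · intro j _ hj
    simp [hj]
  · simp

theorem abs_monom_le {k : ℕ} (hk : 1 ≤ k) {i : Fin n → ℕ} (hi : ∑ s, i s ≤ 2 * k)
    (t : EuclideanSpace ℝ (Fin n)) : |monom i t| ≤ 1 + ∑ s, t s ^ (2 * k) := by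
  set A := 1 + ∑ s, t s ^ (2 * k) with hA
  have hnn : ∀ s, 0 ≤ t s ^ (2 * k) := fun s => (even_two_mul k).pow_nonneg _
  have hA1 : 1 ≤ A := by
    have := Finset.sum_nonneg fun s (_ : s ∈ Finset.univ) => hnn s
    linarith
  have hk0 : 2 * k ≠ 0 := by lia
  -- B dominates every |t_s| and is at least 1, so the total degree can be raised to 2k.
  set B : ℝ := A ^ (((2 * k : ℕ) : ℝ)⁻¹) with hB
  have hB1 : 1 ≤ B := Real.one_le_rpow hA1 (by positivity)
  have hBpow : B ^ (2 * k) = A := Real.rpow_inv_natCast_pow (by linarith) hk0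
  have hts : ∀ s, |t s| ≤ B := by
    intro s
    refine (pow_le_pow_iff_left₀ (abs_nonneg _) (by linarith) hk0).1 ?_
    rw [hBpow, (even_two_mul k).pow_abs]
    have := Finset.single_le_sum (fun s _ => hnn s) (Finset.mem_univ s)
    linarith
  calc |monom i t| = ∏ s, |t s| ^ i s := by
        rw [monom, Finset.abs_prod]
        simp only [abs_pow]
    _ ≤ ∏ s, B ^ i s := Finset.prod_le_prod (fun s _ => by positivity)
        fun s _ => pow_le_pow_left₀ (abs_nonneg _) (hts s) _
    _ = B ^ ∑ s, i s := Finset.prod_pow_eq_pow_sum _ _ _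
    _ ≤ B ^ (2 * k) := pow_le_pow_right₀ hB1 hi
    _ = A := hBpow

end Monomials

/-! ### The moment problem on T. -/

section Main

variable {n : ℕ} {T : Set (EuclideanSpace ℝ (Fin n))} {I : Finset (Fin n → ℕ)} {g : I → ℝ}
  {ρ : EuclideanSpace ℝ (Fin n) → ℝ}

/-- The measure `ρ dt` on `T`. -/
noncomputable def weightMeasure (T : Set (EuclideanSpace ℝ (Fin n)))
    (ρ : EuclideanSpace ℝ (Fin n) → ℝ) : Measure (EuclideanSpace ℝ (Fin n)) :=
  (volume.restrict T).withDensity fun t => ENNReal.ofReal (ρ t)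

/-- The family of monomials with exponents in `I`. -/
def monomFamily (I : Finset (Fin n → ℕ)) (i : I) (t : EuclideanSpace ℝ (Fin n)) : ℝ :=
  monom (i : Fin n → ℕ) t

theorem measurable_monomFamily (I : Finset (Fin n → ℕ)) (i : I) :
    Measurable (monomFamily I i) := (continuous_monom _).measurable

theorem ae_linComb_monomFamily_ne_zero {μ : Measure (EuclideanSpace ℝ (Fin n))}
    (hμ : μ ≪ volume) (q : I → ℝ) (hq : q ≠ 0) : ∀ᵐ t ∂μ, linComb (monomFamily I) q t ≠ 0 :=
  Filter.Eventually.filter_mono hμ.ae_le (ae_sum_mul_monom_ne_zero I q hq)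

theorem weightMeasure_absolutelyContinuous_volume : weightMeasure T ρ ≪ volume :=
  (withDensity_absolutelyContinuous _ _).trans Measure.absolutelyContinuous_restrict

theorem isFiniteMeasure_weightMeasure (hρ : IntegrableOn ρ T volume) :
    IsFiniteMeasure (weightMeasure T ρ) :=
  isFiniteMeasure_withDensity_ofReal hρ.2

theorem lagrangian_eq (hρ : IntegrableOn ρ T volume) (l : I → ℝ) :
    lagrangian T I g ρ l = ((∑ i, g i * l i : ℝ) : EReal) -
      (expIntegral (weightMeasure T ρ) (monomFamily I) l : EReal) := by
  rw [lagrangian, expIntegral, weightMeasure, lintegral_withDensity_eq_lintegral_mul₀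
    hρ.aestronglyMeasurable.aemeasurable.ennreal_ofReal
    (measurable_linComb (measurable_monomFamily I) l).exp.ennreal_ofReal.aemeasurable]
  congr 2
  refine lintegral_congr fun t => ?_
  rw [Pi.mul_apply, ENNReal.ofReal_mul (Real.exp_pos _).le, mul_comm]
  rfl

theorem lagrangian_eq_coe (hρ : IntegrableOn ρ T volume) {l : I → ℝ}
    (hl : expIntegral (weightMeasure T ρ) (monomFamily I) l ≠ ∞) :
    lagrangian T I g ρ l = ((∑ i, g i * l i -
      (expIntegral (weightMeasure T ρ) (monomFamily I) l).toReal : ℝ) : EReal) := by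
  rw [lagrangian_eq hρ, EReal.coe_sub, EReal.coe_ennreal_toReal hl]

theorem lagrangian_eq_bot (hρ : IntegrableOn ρ T volume) {l : I → ℝ}
    (hl : expIntegral (weightMeasure T ρ) (monomFamily I) l = ∞) :
    lagrangian T I g ρ l = ⊥ := by
  rw [lagrangian_eq hρ, hl, EReal.coe_ennreal_top, EReal.sub_top]

/-- L(0) is finite because ρ is integrable, so the supremum is never attained at a point where L =
-∞. -/
theorem lagrangian_eq_iSup_iff (hρ : IntegrableOn ρ T volume) (l : I → ℝ) :
    lagrangian T I g ρ l = (⨆ q : I → ℝ, lagrangian T I g ρ q) ↔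
      IsLagrangianMax (weightMeasure T ρ) (monomFamily I) g l := by
  have := isFiniteMeasure_weightMeasure hρ
  constructor
  · intro h
    have hle : ∀ q, lagrangian T I g ρ q ≤ lagrangian T I g ρ l := fun q =>
      h ▸ le_iSup (fun q : I → ℝ => lagrangian T I g ρ q) q
    have hl : expIntegral (weightMeasure T ρ) (monomFamily I) l ≠ ∞ := by
      intro hl
      have h0 : expIntegral (weightMeasure T ρ) (monomFamily I) 0 ≠ ∞ := by
        rw [expIntegral_zero]
        exact measure_ne_top _ _
      have := hle 0
      rw [lagrangian_eq_bot hρ hl, lagrangian_eq_coe hρ h0, le_bot_iff] at this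
      exact EReal.coe_ne_bot _ this
    refine ⟨hl, fun q hq => ?_⟩
    have := hle q
    rwa [lagrangian_eq_coe hρ hl, lagrangian_eq_coe hρ hq, EReal.coe_le_coe_iff] at this
  · intro h
    refine le_antisymm (le_iSup (fun q : I → ℝ => lagrangian T I g ρ q) l) (iSup_le fun q => ?_)
    by_cases hq : expIntegral (weightMeasure T ρ) (monomFamily I) q = ∞
    · rw [lagrangian_eq_bot hρ hq]
      exact bot_le
    · rw [lagrangian_eq_coe hρ h.1, lagrangian_eq_coe hρ hq, EReal.coe_le_coe_iff]
      exact h.2 q hq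

theorem exists_isLagrangianMax_of_isRepresentingDensity (h0 : (0 : Fin n → ℕ) ∈ I)
    (hg : g ⟨0, h0⟩ = 1) (hρ : IntegrableOn ρ T volume)
    (hρpos : ∀ᵐ t ∂(volume.restrict T), 0 < ρ t) {f : EuclideanSpace ℝ (Fin n) → ℝ}
    (hf : IsRepresentingDensity T I g f) :
    ∃ l, IsLagrangianMax (weightMeasure T ρ) (monomFamily I) g l := by
  obtain ⟨hfint, hf0, hfi⟩ := hf
  have := isFiniteMeasure_weightMeasure hρ
  have hfm := hfint.aestronglyMeasurable.aemeasurable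
  have hmom : ∀ i : I, ∫ t, monomFamily I i t ∂(volume.restrict T).withDensity
      (fun t => ENNReal.ofReal (f t)) = g i := fun i => by
    rw [integral_withDensity_ofReal hfm hf0, ← (hfi i).2]
    exact integral_congr_ae (Filter.Eventually.of_forall fun t => mul_comm _ _)
  have hac : (volume.restrict T).withDensity (fun t => ENNReal.ofReal (f t)) ≪
      volume.restrict T := withDensity_absolutelyContinuous _ _
  refine exists_isLagrangianMax (η := (volume.restrict T).withDensity
    fun t => ENNReal.ofReal (f t)) ?_ ?_ (measurable_monomFamily I) (fun i => ?_)
    (ae_linComb_monomFamily_ne_zero (hac.trans Measure.absolutelyContinuous_restrict)) hmom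
  · exact hac.trans
      (absolutelyContinuous_withDensity_ofReal hρ.aestronglyMeasurable.aemeasurable hρpos)
  · intro h
    have := hmom ⟨0, h0⟩
    rw [h, integral_zero_measure, hg] at this
    exact zero_ne_one this
  · rw [integrable_withDensity_ofReal_iff hfm hf0]
    refine (hfi i).1.mono' (hfm.mul (measurable_monomFamily I i).aemeasurable).aestronglyMeasurable
      ?_
    filter_upwards [hf0] with t ht
    rw [norm_mul, Real.norm_of_nonneg ht, mul_comm]
    rfl

theorem exists_isRepresentingDensity_of_isLagrangianMax {k : ℕ} (hk : 1 ≤ k)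
    (hdeg : ∀ i ∈ I, ∑ s, i s ≤ 2 * k) (hsingle : ∀ s : Fin n, Pi.single s (2 * k) ∈ I)
    (h0 : (0 : Fin n → ℕ) ∈ I) (hg : g ⟨0, h0⟩ = 1) (hρ : IntegrableOn ρ T volume)
    (hρpos : ∀ᵐ t ∂(volume.restrict T), 0 < ρ t) {l : I → ℝ}
    (hl : IsLagrangianMax (weightMeasure T ρ) (monomFamily I) g l) :
    ∃ f, IsRepresentingDensity T I g f := by
  classical
  have hmeas := measurable_monomFamily I
  set μ := weightMeasure T ρ with hμ
  set e : EuclideanSpace ℝ (Fin n) → ℝ := fun t => Real.exp (linComb (monomFamily I) l t) with he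
  have hem : Measurable e := (measurable_linComb hmeas l).exp
  have hepos : ∀ t, 0 < e t := fun t => Real.exp_pos _
  have he0 : ∀ᵐ t ∂μ, 0 ≤ e t := Filter.Eventually.of_forall fun t => (hepos t).le
  have hρm : AEMeasurable ρ (volume.restrict T) := hρ.aestronglyMeasurable.aemeasurable
  have hρ0 : ∀ᵐ t ∂(volume.restrict T), 0 ≤ ρ t := hρpos.mono fun _ ht => ht.le
  have hcoord : ∀ (i : I) (t), linComb (monomFamily I) (Pi.single i 1) t = monom (i : Fin n → ℕ) t :=
    fun i t => by simp [linComb, monomFamily, Pi.single_apply]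
  have hint0 : ∀ i : I, (∀ t, 0 ≤ monom (i : Fin n → ℕ) t) →
      Integrable (fun t => monom (i : Fin n → ℕ) t * e t) μ := fun i hi => by
    have := hl.integrable hmeas (q := Pi.single i 1)
      (Filter.Eventually.of_forall fun t => by rw [hcoord]; exact hi t)
    simpa only [hcoord] using this
  -- The first-order condition controls only nonnegative monomials; 1 and the t_s^{2k} are such, and
  -- they dominate all others.
  have hbd : Integrable (fun t => (1 + ∑ s, t s ^ (2 * k)) * e t) μ := by
    have h1 := hint0 ⟨0, h0⟩ (fun t => by simp [monom_zero])
    have h2 := fun s => hint0 ⟨_, hsingle s⟩ (fun t => by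
      simpa only [monom_single] using (even_two_mul k).pow_nonneg _)
    simp only [monom_zero, monom_single] at h1 h2
    simp only [add_mul, Finset.sum_mul]
    exact h1.add (integrable_finsetSum _ fun s _ => h2 s)
  have hint : ∀ i : I, Integrable (monomFamily I i)
      (μ.withDensity fun t => ENNReal.ofReal (e t)) := fun i => by
    rw [integrable_withDensity_ofReal_iff hem.aemeasurable he0]
    refine hbd.mono' (hem.mul (hmeas i)).aestronglyMeasurable
      (Filter.Eventually.of_forall fun t => ?_)
    rw [norm_mul, Real.norm_of_nonneg (hepos t).le, mul_comm]
    exact mul_le_mul_of_nonneg_right (abs_monom_le hk (hdeg i i.2) t) (hepos t).le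
  have hμ0 : μ ≠ 0 := hl.measure_ne_zero fun h => by
    rw [h] at hg
    exact zero_ne_one hg
  have hacμ : μ ≪ μ.withDensity fun t => ENNReal.ofReal (e t) :=
    absolutelyContinuous_withDensity_ofReal hem.aemeasurable (Filter.Eventually.of_forall hepos)
  obtain ⟨h, hhm, hh0, ⟨C, hC⟩, hhi⟩ := mem_momentCone_of_dominates
    (μ := μ.withDensity fun t => ENNReal.ofReal (e t)) (m := monomFamily I)
    (fun hz => hμ0 (Measure.absolutelyContinuous_zero_iff.1 (hz ▸ hacμ))) hmeas hint
    (ae_linComb_monomFamily_ne_zero ((withDensity_absolutelyContinuous _ _).trans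
      weightMeasure_absolutelyContinuous_volume)) g (fun q hq => by
      rw [integral_withDensity_ofReal hem.aemeasurable he0]
      simpa only [mul_comm] using
        hl.integral_le hmeas (Filter.Eventually.filter_mono hacμ.ae_le hq))
  set f : EuclideanSpace ℝ (Fin n) → ℝ := fun t => ρ t * (e t * h t) with hf
  have hf0 : ∀ᵐ t ∂(volume.restrict T), 0 ≤ f t := by
    filter_upwards [hρ0] with t ht
    exact mul_nonneg ht (mul_nonneg (hepos t).le (hh0 t))
  have hmul : ∀ (i : I) t, monom (i : Fin n → ℕ) t * f t =
      ρ t * (e t * (h t * monomFamily I i t)) := fun i t => by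
    simp only [hf, monomFamily]
    ring
  have hfint : ∀ i : I, IntegrableOn (fun t => monom (i : Fin n → ℕ) t * f t) T volume :=
    fun i => by
      have := integrable_bounded_mul (hint i) hhm hh0 hC
      rw [integrable_withDensity_ofReal_iff hem.aemeasurable he0, hμ, weightMeasure,
        integrable_withDensity_ofReal_iff hρm hρ0] at this
      simpa only [hmul, IntegrableOn] using this
  refine ⟨f, ?_, hf0, fun i => ⟨?_, ?_⟩⟩
  · simpa only [monom_zero, one_mul] using hfint ⟨0, h0⟩
  · refine (hfint i).norm.congr ?_
    filter_upwards [hf0] with t ht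
    rw [norm_mul, Real.norm_of_nonneg ht, Real.norm_eq_abs]
  · rw [← hhi i, integral_withDensity_ofReal hem.aemeasurable he0, hμ, weightMeasure,
      integral_withDensity_ofReal hρm hρ0]
    simp only [hmul]

end Main

theorem theorem3 {n : ℕ}
    (T : Set (EuclideanSpace ℝ (Fin n))) (hT : IsClosed T) (hTreg : IsRegularSupport T)
    (I : Finset (Fin n → ℕ)) (hI : IsRegularIndexSet I)
    (k : ℕ) (hk : 1 ≤ k)
    (hmax : IsGreatest ((fun i : Fin n → ℕ => ∑ s, i s) '' (I : Set (Fin n → ℕ))) (2 * k))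
    (hsingle : ∀ s : Fin n, Pi.single s (2 * k) ∈ I)
    (g : I → ℝ) (h0 : (0 : Fin n → ℕ) ∈ I) (hg : g ⟨0, h0⟩ = 1)
    (ρ : EuclideanSpace ℝ (Fin n) → ℝ) (hρ : IntegrableOn ρ T volume)
    (hρpos : ∀ᵐ t ∂(volume.restrict T), 0 < ρ t) :
    -- solvability of the moment problem iff `L` is bounded above and attains its supremum
    ((∃ f : EuclideanSpace ℝ (Fin n) → ℝ, IsRepresentingDensity T I g f) ↔
      ((∃ M : ℝ, ∀ l : I → ℝ, lagrangian T I g ρ l ≤ (M : EReal)) ∧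
        ∃ lstar : I → ℝ, lagrangian T I g ρ lstar = ⨆ l : I → ℝ, lagrangian T I g ρ l)) ∧
    -- a point where the supremum is attained is unique
    (∀ l₁ l₂ : I → ℝ,
      lagrangian T I g ρ l₁ = (⨆ l : I → ℝ, lagrangian T I g ρ l) →
      lagrangian T I g ρ l₂ = (⨆ l : I → ℝ, lagrangian T I g ρ l) → l₁ = l₂) := by
  refine ⟨⟨fun ⟨f, hf⟩ => ?_, fun ⟨_, l, hl⟩ => ?_⟩, fun l₁ l₂ h₁ h₂ => ?_⟩
  · obtain ⟨l, hl⟩ := exists_isLagrangianMax_of_isRepresentingDensity h0 hg hρ hρpos hf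
    have hsup := (lagrangian_eq_iSup_iff hρ l).2 hl
    refine ⟨⟨∑ i, g i * l i - (expIntegral (weightMeasure T ρ) (monomFamily I) l).toReal,
      fun q => ?_⟩, l, hsup⟩
    rw [← lagrangian_eq_coe hρ hl.1, hsup]
    exact le_iSup (fun q : I → ℝ => lagrangian T I g ρ q) q
  · exact exists_isRepresentingDensity_of_isLagrangianMax hk
      (fun i hi => hmax.2 (Set.mem_image_of_mem _ hi)) hsingle h0 hg hρ hρpos
      ((lagrangian_eq_iSup_iff hρ l).1 hl)
  · rw [lagrangian_eq_iSup_iff hρ] at h₁ h₂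
    have hμ : weightMeasure T ρ ≠ 0 := h₁.measure_ne_zero fun h => by
      rw [h] at hg
      exact zero_ne_one hg
    exact h₁.eq hμ (measurable_monomFamily I)
      (ae_linComb_monomFamily_ne_zero weightMeasure_absolutelyContinuous_volume) h₂
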